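/- Let $(\overline M^{2n+1},\overline g)$ be a semi-Riemannian manifold with Levi-Civita connection $\overline\nabla$ and with an indefinite almost contact metric structure $(\overline\phi,\xi,\eta,\overline g)$, i.e. $\overline\phi^2=-\mathbb I+\eta\otimes\xi$, $\eta(\xi)=1$, $\eta\circ\overline\phi=0$, $\overline\phi\xi=0$, $\overline g(\overline\phi X,\overline\phi Y)=\overline g(X,Y)-\eta(X)\eta(Y)$, $\eta(X)=\overline g(\xi,X)$. Let $\mu\in\mathbb R$ and assume that $\overline M$ is nearly $\mu$-Sasakian: $$(\overline\nabla_X\overline\phi)Y+(\overline\nabla_Y\overline\phi)X=\mu\{2\overline g(X,Y)\xi-\eta(Y)X-\eta(X)Y\}$$ for all vector fields $X,Y$ on $\overline M$. Let $M$ be an immersed $r$-lightlike submanifold of $\overline M$: $\mathrm{Rad}\,TM=TM\cap TM^\perp$ has constant rank $r>0$. Let $S(TM)$ and $S(TM^\perp)$ be complementary subbundles of $\mathrm{Rad}\,TM$ in $TM$ and in $TM^\perp$, let $l\mathrm{tr}(TM)$ be a totally null complement of $\mathrm{Rad}\,TM$ in $S(TM)^\perp\cap S(TM^\perp)^\perp$,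 and let $\mathrm{tr}(TM)=l\mathrm{tr}(TM)\perp S(TM^\perp)$, so that $T\overline M|_M=TM\oplus\mathrm{tr}(TM)$. For vector fields $X,Y$ on $M$ write $\overline\nabla_XY=\nabla_XY+h(X,Y)$ and $\overline\phi X=\phi_1X+\varphi_1X$, with $\nabla_XY,\ \phi_1X$ in $TM$ and $h(X,Y),\ \varphi_1X$ in $\mathrm{tr}(TM)$. Assume that $M$ is a co-screen QGCR-lightlike submanifold: $\xi|_M\in\Gamma(S(TM^\perp))$, and there are smooth subbundles $D_1,D_2\subset\mathrm{Rad}\,TM$, $D_0\subset S(TM)$, $\mathcal L\subset l\mathrm{tr}(TM)$, $\mathcal S\subset S(TM^\perp)$ such that $$\mathrm{Rad}\,TM=D_1\oplus D_2,\quad \overline\phi D_1=D_1,\quad \overline\phi D_2\subset S(TM),\quad S(TM)=\{\overline\phi D_2\oplus\overline D\}\perp D_0,\quad \overline\phi D_0\subseteq D_0,\quad \overline D=\overline\phi\mathcal S\oplus\overline\phi\mathcal L,$$ where $\overline D$ is a vector bundle and $D_0$ is nondegenerate. Put $D=\mathrm{Rad}\,TM\perp D_0\perp\overline\phi D_2$.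 Suppose that $D$ is nearly auto-parallel: $\nabla_XY+\nabla_YX\in\Gamma(D)$ for all $X,Y\in\Gamma(D)$. Then, for all $X,Y\in\Gamma(D)$, the section $$V=h(X,\overline\phi Y)+h(Y,\phi_1X)$$ of $\mathrm{tr}(TM)$ has no component in $\mathcal L\perp\mathcal S$, in the following sense. 1. At every point $V$ lies in $\{N\in l\mathrm{tr}(TM):N\perp D_2\}\perp\{W\in S(TM^\perp):W\perp\mathcal S\}$. (Equivalently, when expanded in a frame $\{N_i\}\cup\{W_\alpha\}$ of $\mathrm{tr}(TM)$, where $\{N_i\}$ is dual to a frame of $\mathrm{Rad}\,TM=D_1\oplus D_2$ adapted to the splitting and $\{W_\alpha\}$ is an orthogonal frame of $S(TM^\perp)$ that contains one of $\mathcal S$, all coefficients of $V$ belonging to $\mathcal L$ and $\mathcal S$ vanish.) 2. At every point $p$ and for every decomposition $\mathrm{tr}(T_pM)=(\mathcal L\perp\mathcal S)\perp\mathcal G\perp\mathbb R\xi$ with $\overline\phi\mathcal G=\mathcal G$, one has $V_p\in\mathcal G\perp\mathbb R\xi$. -/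

import Mathlib

open scoped Manifold ContDiff Topology Bundle

namespace LightlikeGeometry

noncomputable section

/-- The model space of `d`-dimensional manifolds. -/
abbrev Euc (d : ℕ) : Type := EuclideanSpace ℝ (Fin d)

/-- A semi-Riemannian metric on a `d`-dimensional manifold: a smooth symmetric nondegenerate
`(0,2)`-tensor field of constant index. -/
structure SemiRiemannianMetric (d : ℕ) (N : Type*) [TopologicalSpace N] [ChartedSpace (Euc d) N]
    [IsManifold (𝓡 d) ∞ N] where
  /-- the scalar product on each tangent space -/
  inner (x : N) : TangentSpace (𝓡 d) x →L[ℝ] TangentSpace (𝓡 d) x →L[ℝ] ℝ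
  contMDiff : ContMDiff (𝓡 d) ((𝓡 d).prod 𝓘(ℝ, Euc d →L[ℝ] Euc d →L[ℝ] ℝ)) ∞
    (fun x ↦ Bundle.TotalSpace.mk' (Euc d →L[ℝ] Euc d →L[ℝ] ℝ)
      (E := fun x : N ↦ (TangentSpace (𝓡 d) x →L[ℝ] TangentSpace (𝓡 d) x →L[ℝ] ℝ)) x (inner x))
  symm (x : N) (v w : TangentSpace (𝓡 d) x) : inner x v w = inner x w v
  nondegenerate (x : N) (v : TangentSpace (𝓡 d) x) (hv : ∀ w, inner x v w = 0) : v = 0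
  constant_index : ∃ ν : ℕ, ∀ x : N, IsGreatest
    {k : ℕ | ∃ W : Submodule ℝ (TangentSpace (𝓡 d) x), Module.finrank ℝ W = k ∧
      ∀ w ∈ W, w ≠ 0 → inner x w w < 0} ν

section Ambient

variable {d : ℕ} {N : Type*} [TopologicalSpace N] [ChartedSpace (Euc d) N]
  [IsManifold (𝓡 d) ∞ N]

/-- `∇` is the Levi-Civita connection of `g`: it is torsion-free and
`v (g(σ, τ)) = g(∇_v σ, τ) + g(σ, ∇_v τ)`.
(In Mathlib `∇ σ x v` is the covariant derivative of `σ` at `x` in the direction `v`.) -/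
structure IsLeviCivita (g : SemiRiemannianMetric d N)
    (nabla : CovariantDerivative (𝓡 d) (Euc d) (TangentSpace (𝓡 d) : N → Type _)) : Prop where
  torsion_free : ∀ (X Y : ∀ x : N, TangentSpace (𝓡 d) x) (x : N),
    MDifferentiableAt (𝓡 d) ((𝓡 d).prod 𝓘(ℝ, Euc d))
      (fun y ↦ Bundle.TotalSpace.mk' (Euc d) (E := fun z : N ↦ TangentSpace (𝓡 d) z) y (X y)) x →
    MDifferentiableAt (𝓡 d) ((𝓡 d).prod 𝓘(ℝ, Euc d))
      (fun y ↦ Bundle.TotalSpace.mk' (Euc d) (E := fun z : N ↦ TangentSpace (𝓡 d) z) y (Y y)) x →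
      nabla Y x (X x) - nabla X x (Y x) = VectorField.mlieBracket (𝓡 d) X Y x
  metric : ∀ (σ τ : ∀ x : N, TangentSpace (𝓡 d) x) (x : N) (v : TangentSpace (𝓡 d) x),
    MDifferentiableAt (𝓡 d) ((𝓡 d).prod 𝓘(ℝ, Euc d))
      (fun y ↦ Bundle.TotalSpace.mk' (Euc d) (E := fun z : N ↦ TangentSpace (𝓡 d) z) y (σ y)) x →
    MDifferentiableAt (𝓡 d) ((𝓡 d).prod 𝓘(ℝ, Euc d))
      (fun y ↦ Bundle.TotalSpace.mk' (Euc d) (E := fun z : N ↦ TangentSpace (𝓡 d) z) y (τ y)) x →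
      (mfderiv (𝓡 d) 𝓘(ℝ, ℝ) (fun y ↦ g.inner y (σ y) (τ y)) x v : ℝ) =
        g.inner x (nabla σ x v) (τ x) + g.inner x (σ x) (nabla τ x v)

/-- An indefinite almost contact metric structure `(φ, ξ, η, g)`. -/
structure AlmostContactMetric (g : SemiRiemannianMetric d N) where
  /-- the `(1,1)`-tensor field -/
  phi (x : N) : TangentSpace (𝓡 d) x →L[ℝ] TangentSpace (𝓡 d) x
  /-- the structure vector field -/
  xi (x : N) : TangentSpace (𝓡 d) x
  /-- the 1-form -/
  eta (x : N) : TangentSpace (𝓡 d) x →L[ℝ] ℝ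
  phi_smooth : ContMDiff (𝓡 d) ((𝓡 d).prod 𝓘(ℝ, Euc d →L[ℝ] Euc d)) ∞
    (fun x ↦ Bundle.TotalSpace.mk' (Euc d →L[ℝ] Euc d)
      (E := fun x : N ↦ (TangentSpace (𝓡 d) x →L[ℝ] TangentSpace (𝓡 d) x)) x (phi x))
  xi_smooth : ContMDiff (𝓡 d) ((𝓡 d).prod 𝓘(ℝ, Euc d)) ∞
    (fun x ↦ Bundle.TotalSpace.mk' (Euc d) (E := fun x : N ↦ TangentSpace (𝓡 d) x) x (xi x))
  eta_smooth : ContMDiff (𝓡 d) ((𝓡 d).prod 𝓘(ℝ, Euc d →L[ℝ] ℝ)) ∞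
    (fun x ↦ Bundle.TotalSpace.mk' (Euc d →L[ℝ] ℝ)
      (E := fun x : N ↦ (TangentSpace (𝓡 d) x →L[ℝ] ℝ)) x (eta x))
  phi_phi (x : N) (v : TangentSpace (𝓡 d) x) : phi x (phi x v) = -v + eta x v • xi x
  eta_xi (x : N) : eta x (xi x) = 1
  eta_phi (x : N) (v : TangentSpace (𝓡 d) x) : eta x (phi x v) = 0
  phi_xi (x : N) : phi x (xi x) = 0
  inner_phi_phi (x : N) (v w : TangentSpace (𝓡 d) x) :
    g.inner x (phi x v) (phi x w) = g.inner x v w - eta x v * eta x w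
  eta_eq (x : N) (v : TangentSpace (𝓡 d) x) : eta x v = g.inner x (xi x) v

/-- The derivative `(∇_v φ) Y = ∇_v (φ Y) - φ (∇_v Y)` of the `(1,1)`-tensor field `φ`. -/
def covPhi {g : SemiRiemannianMetric d N}
    (nabla : CovariantDerivative (𝓡 d) (Euc d) (TangentSpace (𝓡 d) : N → Type _))
    (c : AlmostContactMetric g) (Y : ∀ x : N, TangentSpace (𝓡 d) x) (x : N)
    (v : TangentSpace (𝓡 d) x) : TangentSpace (𝓡 d) x :=
  nabla (fun y ↦ c.phi y (Y y)) x v - c.phi x (nabla Y x v)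

/-- The nearly `μ`-Sasakian condition, for all vector fields `X`, `Y` smooth at the point `x`:
`(∇_X φ) Y + (∇_Y φ) X = μ {2 g(X, Y) ξ - η(Y) X - η(X) Y}`. -/
def IsNearlySasakian {g : SemiRiemannianMetric d N}
    (nabla : CovariantDerivative (𝓡 d) (Euc d) (TangentSpace (𝓡 d) : N → Type _))
    (c : AlmostContactMetric g) (μ : ℝ) : Prop :=
  ∀ (X Y : ∀ x : N, TangentSpace (𝓡 d) x) (x : N),
    ContMDiffAt (𝓡 d) ((𝓡 d).prod 𝓘(ℝ, Euc d)) ∞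
      (fun y ↦ Bundle.TotalSpace.mk' (Euc d) (E := fun z : N ↦ TangentSpace (𝓡 d) z) y (X y)) x →
    ContMDiffAt (𝓡 d) ((𝓡 d).prod 𝓘(ℝ, Euc d)) ∞
      (fun y ↦ Bundle.TotalSpace.mk' (Euc d) (E := fun z : N ↦ TangentSpace (𝓡 d) z) y (Y y)) x →
      covPhi nabla c Y x (X x) + covPhi nabla c X x (Y x) =
        μ • ((2 * g.inner x (X x) (Y x)) • c.xi x - c.eta x (Y x) • X x - c.eta x (X x) • Y x)

/-- The orthogonal complement of a subspace of `T_x N`. -/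
def perp (g : SemiRiemannianMetric d N) {x : N} (W : Submodule ℝ (TangentSpace (𝓡 d) x)) :
    Submodule ℝ (TangentSpace (𝓡 d) x) where
  carrier := {v | ∀ w ∈ W, g.inner x v w = 0}
  add_mem' := by
    intro a b ha hb w hw
    rw [map_add, add_apply, ha w hw, hb w hw, add_zero]
  zero_mem' := by
    intro w _
    rw [map_zero, zero_apply]
  smul_mem' := by
    intro r a ha w hw
    rw [map_smul, smul_apply, ha w hw, smul_zero]

/-- The image `φ W` of a subspace `W` of `T_x N`. -/
def phiMap {g : SemiRiemannianMetric d N} (c : AlmostContactMetric g) {x : N}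
    (W : Submodule ℝ (TangentSpace (𝓡 d) x)) : Submodule ℝ (TangentSpace (𝓡 d) x) :=
  W.map (c.phi x : TangentSpace (𝓡 d) x →ₗ[ℝ] TangentSpace (𝓡 d) x)

end Ambient

section Submanifold

variable {d m : ℕ} {N : Type*} [TopologicalSpace N] [ChartedSpace (Euc d) N]
  [IsManifold (𝓡 d) ∞ N]
  {M : Type*} [TopologicalSpace M] [ChartedSpace (Euc m) M]

/-- `F` is a smooth vector subbundle of rank `k` of the restriction of `TN` to `M` (that is, of the
pull-back of `TN` by `i`): it is locally spanned by `k` smooth, pointwise linearly independent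
sections. -/
def IsSubbundle (i : M → N) (F : ∀ p : M, Submodule ℝ (TangentSpace (𝓡 d) (i p))) (k : ℕ) :
    Prop :=
  ∀ p₀ : M, ∃ U ∈ 𝓝 p₀, ∃ s : Fin k → ∀ p : M, TangentSpace (𝓡 d) (i p),
    (∀ j, ContMDiffOn (𝓡 m) ((𝓡 d).prod 𝓘(ℝ, Euc d)) ∞
      (fun p ↦ Bundle.TotalSpace.mk' (Euc d) (E := fun x : N ↦ TangentSpace (𝓡 d) x)
        (i p) (s j p)) U) ∧
    ∀ p ∈ U, LinearIndependent ℝ (fun j ↦ s j p) ∧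
      Submodule.span ℝ (Set.range fun j ↦ s j p) = F p

/-- The tangent space `T_p M`, as a subspace of `T_{i p} N`. -/
def tangent (d m : ℕ) {N : Type*} [TopologicalSpace N] [ChartedSpace (Euc d) N]
    {M : Type*} [TopologicalSpace M] [ChartedSpace (Euc m) M] (i : M → N) (p : M) :
    Submodule ℝ (TangentSpace (𝓡 d) (i p)) :=
  LinearMap.range
    (mfderiv (𝓡 m) (𝓡 d) i p : TangentSpace (𝓡 m) p →ₗ[ℝ] TangentSpace (𝓡 d) (i p))

/-- The vector field along `i` given by a vector field on `M`. -/
def push (d m : ℕ) {N : Type*} [TopologicalSpace N] [ChartedSpace (Euc d) N]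
    {M : Type*} [TopologicalSpace M] [ChartedSpace (Euc m) M] (i : M → N)
    (X : ∀ p : M, TangentSpace (𝓡 m) p) (p : M) : TangentSpace (𝓡 d) (i p) :=
  mfderiv (𝓡 m) (𝓡 d) i p (X p)

/-- The connection `∇` of `N` acting on vector fields `Z` along `i : M → N`, i.e. the pull-back
connection: if `Z = ∑ Zᵏ (eₖ ∘ i)` near `p`, where `(eₖ)` is the coordinate frame of the standard
trivialization of `TN` around `i p`, then
`∇_v Z = ∑ dZᵏ(v) eₖ + ∇_{di(v)} (∑ Zᵏ(p) eₖ)`.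
For `Z = Y ∘ i` with `Y` a vector field on `N` this is `∇_{di(v)} Y`, see `covAlong_comp`. -/
def covAlong (nabla : CovariantDerivative (𝓡 d) (Euc d) (TangentSpace (𝓡 d) : N → Type _))
    (i : M → N) (Z : ∀ p : M, TangentSpace (𝓡 d) (i p)) (p : M) (v : TangentSpace (𝓡 m) p) :
    TangentSpace (𝓡 d) (i p) :=
  (trivializationAt (Euc d) (TangentSpace (𝓡 d)) (i p)).symmL ℝ (i p)
      (mfderiv (𝓡 m) 𝓘(ℝ, Euc d)
        (fun q ↦ (trivializationAt (Euc d) (TangentSpace (𝓡 d)) (i p)).continuousLinearMapAt ℝ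
          (i q) (Z q)) p v) +
    nabla (FiberBundle.extend (Euc d) (Z p)) (i p) (mfderiv (𝓡 m) (𝓡 d) i p v)

/-- A differentiable section is differentiable in the standard trivialization. -/
theorem mdiff_triv (Y : ∀ x : N, TangentSpace (𝓡 d) x) (x : N)
    (hY : MDifferentiableAt (𝓡 d) ((𝓡 d).prod 𝓘(ℝ, Euc d))
      (fun y ↦ Bundle.TotalSpace.mk' (Euc d) (E := fun z : N ↦ TangentSpace (𝓡 d) z) y (Y y)) x) :
    MDifferentiableAt (𝓡 d) 𝓘(ℝ, Euc d) (fun y ↦ (trivializationAt (Euc d)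
      (TangentSpace (𝓡 d)) x).continuousLinearMapAt ℝ y (Y y)) x := by
  have hx : x ∈ (trivializationAt (Euc d) (TangentSpace (𝓡 d)) x).baseSet :=
    FiberBundle.mem_baseSet_trivializationAt' x
  have h := (Bundle.Trivialization.mdifferentiableAt_section_iff (𝓡 d)
    (trivializationAt (Euc d) (TangentSpace (𝓡 d)) x) Y hx).1 hY
  refine h.congr_of_eventuallyEq ?_
  filter_upwards [(trivializationAt (Euc d) (TangentSpace (𝓡 d)) x).open_baseSet.mem_nhds hx]
    with y hy
  exact Bundle.Trivialization.continuousLinearMapAt_apply_of_mem (R := ℝ) _ hy _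

/-- Local expression of a covariant derivative in the standard trivialization. -/
theorem cov_eq (nabla : CovariantDerivative (𝓡 d) (Euc d) (TangentSpace (𝓡 d) : N → Type _))
    (Y : ∀ x : N, TangentSpace (𝓡 d) x) (x : N) (w : TangentSpace (𝓡 d) x)
    (hY : MDifferentiableAt (𝓡 d) ((𝓡 d).prod 𝓘(ℝ, Euc d))
      (fun y ↦ Bundle.TotalSpace.mk' (Euc d) (E := fun z : N ↦ TangentSpace (𝓡 d) z) y (Y y)) x) :
    nabla Y x w =
      (trivializationAt (Euc d) (TangentSpace (𝓡 d)) x).symmL ℝ x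
        (mfderiv (𝓡 d) 𝓘(ℝ, Euc d) (fun y ↦ (trivializationAt (Euc d)
          (TangentSpace (𝓡 d)) x).continuousLinearMapAt ℝ y (Y y)) x w) +
      nabla (FiberBundle.extend (Euc d) (Y x)) x w := by
  set T := trivializationAt (Euc d) (TangentSpace (𝓡 d)) x with hT
  have hx : x ∈ T.baseSet := FiberBundle.mem_baseSet_trivializationAt' x
  let Φ : (∀ x : N, TangentSpace (𝓡 d) x) → TangentSpace (𝓡 d) x := fun Y ↦
    nabla Y x w - T.symmL ℝ x
      (mvfderiv (𝓡 d) (fun y ↦ T.continuousLinearMapAt ℝ y (Y y)) x w)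
  have hΦ : TensorialAt (𝓡 d) (Euc d) Φ x := by
    constructor
    · intro f σ hf hσ
      have h1 := nabla.isCovariantDerivativeOnUniv.leibniz hσ hf
      have h0 : MDifferentiableAt (𝓡 d) 𝓘(ℝ, Euc d)
        (fun y ↦ T.continuousLinearMapAt ℝ y (σ y)) x := mdiff_triv σ x hσ
      have h2 := mvfderiv_smul hf h0
      have h3 : (fun y ↦ T.continuousLinearMapAt ℝ y ((f • σ) y)) =
        f • (fun y ↦ T.continuousLinearMapAt ℝ y (σ y)) := by
        funext y; simp
      have h4 := T.symmL_continuousLinearMapAt (R := ℝ) hx (σ x)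
      simp only [Φ]
      rw [h3, h2, h1]
      simp only [add_apply, smul_apply, ContinuousLinearMap.smulRight_apply, map_add, map_smul, h4]
      module
    · intro σ σ' hσ hσ'
      have h1 := nabla.isCovariantDerivativeOnUniv.add hσ hσ'
      have h2 := mvfderiv_add (mdiff_triv σ x hσ) (mdiff_triv σ' x hσ')
      have h3 : (fun y ↦ T.continuousLinearMapAt ℝ y ((σ + σ') y)) =
        (fun y ↦ T.continuousLinearMapAt ℝ y (σ y)) +
          (fun y ↦ T.continuousLinearMapAt ℝ y (σ' y)) := by
        funext y; simp
      simp only [Φ]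
      rw [h3, h2, h1]
      simp only [add_apply, map_add]
      abel
  have key : Φ Y = Φ (FiberBundle.extend (Euc d) (Y x)) :=
    hΦ.pointwise hY (FiberBundle.mdifferentiableAt_extend ..) (by simp)
  have hz : mvfderiv (𝓡 d) (fun y ↦ T.continuousLinearMapAt ℝ y
      (FiberBundle.extend (Euc d) (Y x) y)) x = 0 := by
    have h : (fun y ↦ T.continuousLinearMapAt ℝ y (FiberBundle.extend (Euc d) (Y x) y)) =ᶠ[𝓝 x]
        fun _ ↦ (T ⟨x, Y x⟩).2 := by
      filter_upwards [T.open_baseSet.mem_nhds hx] with y hy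
      have h5 := T.continuousLinearMapAt_symmL (R := ℝ) hy (T ⟨x, Y x⟩).2
      rw [T.symmL_apply hy] at h5
      exact h5
    have h6 : mfderiv (𝓡 d) 𝓘(ℝ, Euc d) (fun y ↦ T.continuousLinearMapAt ℝ y
      (FiberBundle.extend (Euc d) (Y x) y)) x = 0 := h.mfderiv_eq.trans mfderiv_const
    refine ContinuousLinearMap.ext fun u ↦ ?_
    exact congrArg (fun L ↦ L u) h6
  simp only [Φ] at key
  rw [hz] at key
  simp only [zero_apply, map_zero, sub_zero] at key
  rw [← key]
  exact (add_sub_cancel _ _).symm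

/-- On the restriction to `M` of a vector field `Y` of `N`, `covAlong` is the connection of `N`. -/
theorem covAlong_comp
    (nabla : CovariantDerivative (𝓡 d) (Euc d) (TangentSpace (𝓡 d) : N → Type _))
    (i : M → N) (Y : ∀ x : N, TangentSpace (𝓡 d) x) (p : M) (v : TangentSpace (𝓡 m) p)
    (hi : MDifferentiableAt (𝓡 m) (𝓡 d) i p)
    (hY : MDifferentiableAt (𝓡 d) ((𝓡 d).prod 𝓘(ℝ, Euc d))
      (fun y ↦ Bundle.TotalSpace.mk' (Euc d) (E := fun z : N ↦ TangentSpace (𝓡 d) z) y (Y y))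
      (i p)) :
    covAlong nabla i (fun q ↦ Y (i q)) p v = nabla Y (i p) (mfderiv (𝓡 m) (𝓡 d) i p v) := by
  rw [cov_eq nabla Y (i p) _ hY]
  have h := mfderiv_comp p (mdiff_triv Y (i p) hY) hi
  unfold covAlong
  congr 2
  exact congrArg (fun L ↦ L v) h

/-- The radical `Rad T_p M = T_p M ∩ (T_p M)^⊥`. -/
def rad (g : SemiRiemannianMetric d N) (m : ℕ) {M : Type*} [TopologicalSpace M]
    [ChartedSpace (Euc m) M] (i : M → N) (p : M) : Submodule ℝ (TangentSpace (𝓡 d) (i p)) :=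
  tangent d m i p ⊓ perp g (tangent d m i p)

/-- The structure of an `r`-lightlike submanifold `(M, g, S(TM), S(TM^⊥))` on an immersion
`i : M → N`, together with a lightlike transversal bundle. -/
structure LightlikeSubmanifold (g : SemiRiemannianMetric d N) (i : M → N) (r : ℕ) where
  rank_pos : 0 < r
  rad_subbundle : IsSubbundle (m := m) i (rad g m i) r
  /-- the screen distribution `S(TM)` -/
  scr (p : M) : Submodule ℝ (TangentSpace (𝓡 d) (i p))
  scr_subbundle : ∃ k, IsSubbundle (m := m) i scr k
  scr_disjoint (p : M) : Disjoint (rad g m i p) (scr p)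
  scr_sup (p : M) : rad g m i p ⊔ scr p = tangent d m i p
  /-- the screen transversal bundle `S(TM^⊥)` -/
  scrPerp (p : M) : Submodule ℝ (TangentSpace (𝓡 d) (i p))
  scrPerp_subbundle : ∃ k, IsSubbundle (m := m) i scrPerp k
  scrPerp_disjoint (p : M) : Disjoint (rad g m i p) (scrPerp p)
  scrPerp_sup (p : M) : rad g m i p ⊔ scrPerp p = perp g (tangent d m i p)
  /-- the lightlike transversal bundle `ltr(TM)`: a totally null complement of `Rad TM` in the
  orthogonal complement of `S(TM) ⊥ S(TM^⊥)`; equivalently it is locally spanned by null fields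
  `N₁, …, N_r` with `g(E_i, N_j) = δ_ij` -/
  ltr (p : M) : Submodule ℝ (TangentSpace (𝓡 d) (i p))
  ltr_subbundle : IsSubbundle (m := m) i ltr r
  ltr_null (p : M) : ∀ v ∈ ltr p, ∀ w ∈ ltr p, g.inner (i p) v w = 0
  ltr_disjoint (p : M) : Disjoint (rad g m i p) (ltr p)
  ltr_sup (p : M) : rad g m i p ⊔ ltr p = perp g (scr p) ⊓ perp g (scrPerp p)
  /-- the transversal bundle `tr(TM) = ltr(TM) ⊥ S(TM^⊥)` is a complement of `TM` in `TN` -/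
  isCompl_tr (p : M) : IsCompl (tangent d m i p) (ltr p ⊔ scrPerp p)

namespace LightlikeSubmanifold

variable {g : SemiRiemannianMetric d N} {i : M → N} {r : ℕ}

/-- The transversal bundle `tr(TM) = ltr(TM) ⊥ S(TM^⊥)`. -/
def tr (S : LightlikeSubmanifold (m := m) g i r) (p : M) :
    Submodule ℝ (TangentSpace (𝓡 d) (i p)) :=
  S.ltr p ⊔ S.scrPerp p

/-- The component in `TM` of a vector of `TN = TM ⊕ tr(TM)`. -/
def tanPart (S : LightlikeSubmanifold (m := m) g i r) (p : M) (v : TangentSpace (𝓡 d) (i p)) :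
    TangentSpace (𝓡 d) (i p) :=
  Submodule.projection _ _ (S.isCompl_tr p) v

/-- The component in `tr(TM)` of a vector of `TN = TM ⊕ tr(TM)`. -/
def trPart (S : LightlikeSubmanifold (m := m) g i r) (p : M) (v : TangentSpace (𝓡 d) (i p)) :
    TangentSpace (𝓡 d) (i p) :=
  Submodule.projection _ _ (S.isCompl_tr p).symm v

/-- The induced connection `∇_X Z` of `M`: the tangential part of the ambient derivative. -/
def inducedConn (S : LightlikeSubmanifold (m := m) g i r)
    (nabla : CovariantDerivative (𝓡 d) (Euc d) (TangentSpace (𝓡 d) : N → Type _))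
    (X : ∀ p : M, TangentSpace (𝓡 m) p) (Z : ∀ p : M, TangentSpace (𝓡 d) (i p)) (p : M) :
    TangentSpace (𝓡 d) (i p) :=
  S.tanPart p (covAlong nabla i Z p (X p))

/-- The second fundamental form `h(X, Z)` of `M`: the transversal part of the ambient derivative
of `Z` (a tangent vector field of `M`, seen as a field along `i`) in the direction `X`. -/
def secondForm (S : LightlikeSubmanifold (m := m) g i r)
    (nabla : CovariantDerivative (𝓡 d) (Euc d) (TangentSpace (𝓡 d) : N → Type _))
    (X : ∀ p : M, TangentSpace (𝓡 m) p) (Z : ∀ p : M, TangentSpace (𝓡 d) (i p)) (p : M) :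
    TangentSpace (𝓡 d) (i p) :=
  S.trPart p (covAlong nabla i Z p (X p))

end LightlikeSubmanifold

/-- The structure of a quasi generalized CR (QGCR)-lightlike submanifold:
`Rad TM = D₁ ⊕ D₂`, `φ D₁ = D₁`, `φ D₂ ⊂ S(TM)`, `S(TM) = {φ D₂ ⊕ D̄} ⊥ D₀`, `φ D₀ ⊆ D₀`,
`D̄ = φ 𝒮 ⊕ φ ℒ`, with `D₀` nondegenerate, `ℒ ⊂ ltr(TM)` and `𝒮 ⊂ S(TM^⊥)`. -/
structure QGCR {g : SemiRiemannianMetric d N} (c : AlmostContactMetric g) {i : M → N} {r : ℕ}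
    (S : LightlikeSubmanifold (m := m) g i r) where
  /-- the distribution `D₁` -/
  D1 (p : M) : Submodule ℝ (TangentSpace (𝓡 d) (i p))
  /-- the distribution `D₂` -/
  D2 (p : M) : Submodule ℝ (TangentSpace (𝓡 d) (i p))
  /-- the distribution `D₀` -/
  D0 (p : M) : Submodule ℝ (TangentSpace (𝓡 d) (i p))
  /-- the subbundle `ℒ` of `ltr(TM)` -/
  L (p : M) : Submodule ℝ (TangentSpace (𝓡 d) (i p))
  /-- the subbundle `𝒮` of `S(TM^⊥)` -/
  Sbar (p : M) : Submodule ℝ (TangentSpace (𝓡 d) (i p))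
  D1_subbundle : ∃ k, IsSubbundle (m := m) i D1 k
  D2_subbundle : ∃ k, IsSubbundle (m := m) i D2 k
  D0_subbundle : ∃ k, IsSubbundle (m := m) i D0 k
  L_subbundle : ∃ k, IsSubbundle (m := m) i L k
  Sbar_subbundle : ∃ k, IsSubbundle (m := m) i Sbar k
  L_le (p : M) : L p ≤ S.ltr p
  Sbar_le (p : M) : Sbar p ≤ S.scrPerp p
  rad_disjoint (p : M) : Disjoint (D1 p) (D2 p)
  rad_eq (p : M) : D1 p ⊔ D2 p = rad g m i p
  phi_D1 (p : M) : phiMap c (D1 p) = D1 p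
  phi_D2 (p : M) : phiMap c (D2 p) ≤ S.scr p
  Dbar_disjoint (p : M) : Disjoint (phiMap c (Sbar p)) (phiMap c (L p))
  Dbar_subbundle : ∃ k, IsSubbundle (m := m) i (fun p ↦ phiMap c (Sbar p) ⊔ phiMap c (L p)) k
  scr_disjoint (p : M) :
    Disjoint (phiMap c (D2 p)) (phiMap c (Sbar p) ⊔ phiMap c (L p))
  scr_disjoint_D0 (p : M) :
    Disjoint (phiMap c (D2 p) ⊔ (phiMap c (Sbar p) ⊔ phiMap c (L p))) (D0 p)
  scr_orthogonal_D0 (p : M) :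
    ∀ v ∈ phiMap c (D2 p) ⊔ (phiMap c (Sbar p) ⊔ phiMap c (L p)), ∀ w ∈ D0 p,
      g.inner (i p) v w = 0
  scr_eq (p : M) :
    (phiMap c (D2 p) ⊔ (phiMap c (Sbar p) ⊔ phiMap c (L p))) ⊔ D0 p = S.scr p
  phi_D0 (p : M) : phiMap c (D0 p) ≤ D0 p
  D0_nondegenerate (p : M) : Disjoint (D0 p) (perp g (D0 p))

namespace QGCR

variable [IsManifold (𝓡 m) ∞ M] {g : SemiRiemannianMetric d N} {c : AlmostContactMetric g} {i : M → N} {r : ℕ}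
  {S : LightlikeSubmanifold (m := m) g i r}

/-- The distribution `D = Rad TM ⊥ D₀ ⊥ φ D₂` of a co-screen QGCR-lightlike submanifold. -/
def D (Q : QGCR c S) (p : M) : Submodule ℝ (TangentSpace (𝓡 d) (i p)) :=
  rad g m i p ⊔ Q.D0 p ⊔ phiMap c (Q.D2 p)

/-- `M` is co-screen: the structure vector field is a section of `S(TM^⊥)`. -/
def IsCoScreen (_Q : QGCR c S) : Prop :=
  ∀ p : M, c.xi (i p) ∈ S.scrPerp p

/-- `X` is a smooth vector field on `M` with values in `D`, i.e. `X ∈ Γ(D)`. -/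
def IsSectionD (Q : QGCR c S) (X : ∀ p : M, TangentSpace (𝓡 m) p) : Prop :=
  ContMDiff (𝓡 m) ((𝓡 m).prod 𝓘(ℝ, Euc m)) ∞
    (fun p ↦ Bundle.TotalSpace.mk' (Euc m) (E := fun q : M ↦ TangentSpace (𝓡 m) q) p (X p)) ∧
  ∀ p : M, push d m i X p ∈ Q.D p

/-- `D` is nearly auto-parallel: `∇_X Y + ∇_Y X ∈ Γ(D)` for all `X, Y ∈ Γ(D)`, where `∇` is the
induced connection. -/
def IsNearlyAutoParallel (Q : QGCR c S)
    (nabla : CovariantDerivative (𝓡 d) (Euc d) (TangentSpace (𝓡 d) : N → Type _)) : Prop :=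
  ∀ X Y : ∀ p : M, TangentSpace (𝓡 m) p, Q.IsSectionD X → Q.IsSectionD Y → ∀ p : M,
    S.inducedConn nabla X (push d m i Y) p + S.inducedConn nabla Y (push d m i X) p ∈ Q.D p

/-- The vectors of `tr(TM)` without component in `ℒ ⊥ 𝒮`: if `N_i` are the elements of a null frame
of `ltr(TM)` dual to a frame `E_i` of `Rad TM = D₁ ⊕ D₂`, and `W_α` an orthogonal frame of
`S(TM^⊥)` containing one of `𝒮`, the coefficients along `ℒ` and `𝒮` of a vector `V` of `tr(TM)` are
`g(V, E_i)` with `E_i ∈ D₂` and `ε_α g(V, W_α)` with `W_α ∈ 𝒮`; they all vanish if and only if `V`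
lies in the sum of `{N ∈ ltr(TM) : N ⊥ D₂}` and `{W ∈ S(TM^⊥) : W ⊥ 𝒮}`. -/
def noLS (Q : QGCR c S) (p : M) : Submodule ℝ (TangentSpace (𝓡 d) (i p)) :=
  (S.ltr p ⊓ perp g (Q.D2 p)) ⊔ (S.scrPerp p ⊓ perp g (Q.Sbar p))

/-- `G` is the fibre at `p` of a bundle `𝒢` in a decomposition
`tr(TM) = (ℒ ⊥ 𝒮) ⊥ 𝒢 ⊥ ℝξ` with `φ 𝒢 = 𝒢`. -/
structure IsInvariantComplement (Q : QGCR c S) (p : M)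
    (G : Submodule ℝ (TangentSpace (𝓡 d) (i p))) : Prop where
  phi_G : phiMap c G = G
  sup_eq : (Q.L p ⊔ Q.Sbar p) ⊔ G ⊔ Submodule.span ℝ {c.xi (i p)} = S.tr p
  disjoint_G : Disjoint (Q.L p ⊔ Q.Sbar p) G
  disjoint_xi : Disjoint ((Q.L p ⊔ Q.Sbar p) ⊔ G) (Submodule.span ℝ {c.xi (i p)})
  orthogonal_G : ∀ v ∈ Q.L p ⊔ Q.Sbar p, ∀ w ∈ G, g.inner (i p) v w = 0
  orthogonal_xi : ∀ v ∈ (Q.L p ⊔ Q.Sbar p) ⊔ G, g.inner (i p) v (c.xi (i p)) = 0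

end QGCR

end Submanifold

end

end LightlikeGeometry

namespace LightlikeGeometry

noncomputable section

/-! ### Immersions in slice charts, and extension of fields to the ambient manifold. -/

section Immersion

variable {d m : ℕ} {N : Type*} [TopologicalSpace N] [ChartedSpace (Euc d) N]
  [IsManifold (𝓡 d) ∞ N]
  {M : Type*} [TopologicalSpace M] [ChartedSpace (Euc m) M]

/-! Put `H = h(X,Y) + h(Y,X)`. The claim reduces to the pointwise identity `V = tr(φ H)`, where `tr`
denotes the component in `tr(TM)`, followed by linear algebra.

Since `ξ` is normal to `M`, `η` vanishes on `TM` and `D` is `φ`-invariant, so `φ₁X = φX`. The nearly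
Sasakian identity along `M` (`IsNearlySasakian.covAlong_phi_add`) then says that the sum of the
ambient derivatives of `φY` along `X` and of `φX` along `Y` is `φ(C) + 2μ g(X,Y) ξ`, where `C` is
the symmetrized ambient derivative of `X` and `Y`. Its tangential part lies in `D` by near
auto-parallelism, hence so does its image under `φ`; only `φ H` and the `ξ`-term contribute to `V`.

The `ξ`-term must be removed, because `ξ` is not assumed orthogonal to `𝒮`. In fact `μ g = 0` on `D`
(`mul_inner_eq_zero_of_invariant`): the nearly Sasakian identity gives `g(∇_u ξ, φw) - g(∇_{φu} ξ,
w) = -2μ g(u,w)`, and because `g(∇ξ, ·)` is symmetric on `TM` for the normal field `ξ`, the left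
side is antisymmetric in `u, w` while the right side is symmetric.

Finally, `φ` is skew and sends `D₂`, `ℒ` and `𝒮` into `S(TM)`, which is tangent and orthogonal to
`tr(TM)`. Pairing `φ H` with `D₂` and `𝒮` thus gives zero (`trPart_phi_mem_noLS`); decomposing `H`
instead leaves only the `𝒢`-part of `φ H` (`IsInvariantComplement.trPart_phi_mem`). -/

theorem two_le_infty : (2 : ℕ∞ω) ≤ ∞ := by
  exact ENat.LEInfty.out

theorem three_le_infty : (3 : ℕ∞ω) ≤ ∞ := by
  exact ENat.LEInfty.out

-- The slice form of an immersion, stated at points of `M` instead of at their coordinates.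
omit [IsManifold (𝓡 d) ∞ N] in
theorem codChart_apply_eq {i : M → N} {p q : M}
    (hi : Manifold.IsImmersionAt (𝓡 m) (𝓡 d) ∞ i p) (hq : q ∈ hi.domChart.source) :
    hi.codChart (i q) = hi.equiv (hi.domChart q, 0) := by
  have h := hi.writtenInCharts
    ((hi.domChart.extend (𝓡 m)).map_source (by rwa [OpenPartialHomeomorph.extend_source]))
  simpa [hi.domChart.left_inv hq] using h

omit [IsManifold (𝓡 d) ∞ N] in
/-- An immersion has a smooth local left inverse. -/
theorem exists_local_left_inverse {i : M → N} {p : M}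
    (hi : Manifold.IsImmersionAt (𝓡 m) (𝓡 d) ∞ i p) :
    ∃ ρ : N → M, ρ (i p) = p ∧ ContMDiffAt (𝓡 d) (𝓡 m) ∞ ρ (i p) ∧ ∀ᶠ q in 𝓝 p, ρ (i q) = q := by
  have key : ∀ q ∈ hi.domChart.source,
      hi.domChart.symm (hi.equiv.symm (hi.codChart (i q))).1 = q := by
    intro q hq
    rw [codChart_apply_eq hi hq]
    simp [hi.domChart.left_inv hq]
  -- In slice coordinates `M` is the first factor, so the left inverse is the projection that drops
  -- the complementary coordinates.
  refine ⟨fun y ↦ hi.domChart.symm (hi.equiv.symm (hi.codChart y)).1,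
    key p hi.mem_domChart_source, ?_, ?_⟩
  · have h1 : ContMDiffAt (𝓡 d) (𝓡 d) ∞ hi.codChart (i p) :=
      contMDiffAt_of_mem_maximalAtlas hi.codChart_mem_maximalAtlas hi.mem_codChart_source
    have h2 : ContMDiff (𝓡 d) (𝓡 m) ∞ (fun z : Euc d ↦ (hi.equiv.symm z).1) :=
      (ContinuousLinearMap.contDiff ((ContinuousLinearMap.fst ℝ (Euc m) hi.complement).comp
        (hi.equiv.symm : Euc d →L[ℝ] Euc m × hi.complement))).contMDiff
    have hp : (hi.equiv.symm (hi.codChart (i p))).1 = hi.domChart p := by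
      rw [codChart_apply_eq hi hi.mem_domChart_source]; simp
    have h3 : ContMDiffAt (𝓡 m) (𝓡 m) ∞ hi.domChart.symm
        (hi.equiv.symm (hi.codChart (i p))).1 := by
      refine contMDiffAt_symm_of_mem_maximalAtlas hi.domChart_mem_maximalAtlas ?_
      rw [hp]
      exact hi.domChart.map_source hi.mem_domChart_source
    exact ContMDiffAt.comp (i p) h3 (h2.contMDiffAt.comp (i p) h1)
  · filter_upwards [hi.domChart.open_source.mem_nhds hi.mem_domChart_source] with q hq
    exact key q hq

/-- A smooth vector field along an immersion is locally the restriction of a smooth vector field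
of the ambient manifold. -/
theorem exists_ambient_extension {i : M → N} {p : M}
    (hi : Manifold.IsImmersionAt (𝓡 m) (𝓡 d) ∞ i p) (Z : ∀ q : M, TangentSpace (𝓡 d) (i q))
    (hZ : ContMDiffAt (𝓡 m) ((𝓡 d).prod 𝓘(ℝ, Euc d)) ∞
      (fun q ↦ Bundle.TotalSpace.mk' (Euc d) (E := fun x : N ↦ TangentSpace (𝓡 d) x)
        (i q) (Z q)) p) :
    ∃ Y : ∀ x : N, TangentSpace (𝓡 d) x,
      ContMDiffAt (𝓡 d) ((𝓡 d).prod 𝓘(ℝ, Euc d)) ∞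
        (fun y ↦ Bundle.TotalSpace.mk' (Euc d) (E := fun z : N ↦ TangentSpace (𝓡 d) z) y (Y y))
        (i p) ∧
      ∀ᶠ q in 𝓝 p, Y (i q) = Z q := by
  obtain ⟨ρ, hρp, hρ, hρi⟩ := exists_local_left_inverse hi
  set T := trivializationAt (Euc d) (TangentSpace (𝓡 d) : N → Type _) (i p) with hT
  have hp : i p ∈ T.baseSet := FiberBundle.mem_baseSet_trivializationAt' (i p)
  have hF := (Bundle.contMDiffAt_totalSpace.1 hZ).2
  -- The extension is `Z ∘ ρ`, but `Z (ρ y)` is a vector at `i (ρ y)`, not at `y`; the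
  -- trivialization `T` moves it to the fibre over `y` with the same components.
  refine ⟨fun y ↦ T.symmL ℝ y (T ⟨i (ρ y), Z (ρ y)⟩).2, ?_, ?_⟩
  · rw [Bundle.Trivialization.contMDiffAt_section_iff T hp]
    have h : ContMDiffAt (𝓡 d) 𝓘(ℝ, Euc d) ∞ (fun y ↦ (T ⟨i (ρ y), Z (ρ y)⟩).2) (i p) := by
      refine ContMDiffAt.comp (i p) (g := fun q ↦ (T ⟨i q, Z q⟩).2) (f := ρ) ?_ hρ
      rw [hρp]
      exact hF
    refine h.congr_of_eventuallyEq ?_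
    filter_upwards [T.open_baseSet.mem_nhds hp] with y hy
    rw [← T.continuousLinearMapAt_apply_of_mem (R := ℝ) hy, T.continuousLinearMapAt_symmL hy]
  · have hc : ContinuousAt i p := hi.continuousAt
    filter_upwards [hρi, hc (T.open_baseSet.mem_nhds hp)] with q hq hq'
    have hq'' : i q ∈ T.baseSet := hq'
    -- The two vectors lie in fibres that are equal only propositionally, so they are compared in
    -- the total space.
    have h : (⟨i (ρ (i q)), Z (ρ (i q))⟩ : Bundle.TotalSpace (Euc d)
        (TangentSpace (𝓡 d) : N → Type _)) = ⟨i q, Z q⟩ := by rw [hq]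
    rw [h, ← T.continuousLinearMapAt_apply_of_mem (R := ℝ) hq'', T.symmL_continuousLinearMapAt hq'']

/-- Locality of the pull-back connection: it allows a field along `i` to be replaced by an extension
that agrees with it only near `p`. -/
theorem covAlong_congr
    (nabla : CovariantDerivative (𝓡 d) (Euc d) (TangentSpace (𝓡 d) : N → Type _))
    {i : M → N} {Z Z' : ∀ q : M, TangentSpace (𝓡 d) (i q)} {p : M}
    (h : ∀ᶠ q in 𝓝 p, Z q = Z' q) (v : TangentSpace (𝓡 m) p) :
    covAlong nabla i Z p v = covAlong nabla i Z' p v := by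
  unfold covAlong
  rw [h.self_of_nhds]
  congr 2
  have h' : (fun q ↦ (trivializationAt (Euc d) (TangentSpace (𝓡 d)) (i p)).continuousLinearMapAt ℝ
        (i q) (Z q)) =ᶠ[𝓝 p]
      (fun q ↦ (trivializationAt (Euc d) (TangentSpace (𝓡 d)) (i p)).continuousLinearMapAt ℝ
        (i q) (Z' q)) := by
    filter_upwards [h] with q hq
    rw [hq]
  exact congrArg (fun L : TangentSpace (𝓡 m) p →L[ℝ] Euc d ↦ L v) h'.mfderiv_eq

/-- Pushing forward a smooth vector field by a smooth map gives a smooth field along that map. -/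
theorem contMDiff_push [IsManifold (𝓡 m) ∞ M] {i : M → N} (hi : ContMDiff (𝓡 m) (𝓡 d) ∞ i)
    {X : ∀ p : M, TangentSpace (𝓡 m) p}
    (hX : ContMDiff (𝓡 m) ((𝓡 m).prod 𝓘(ℝ, Euc m)) ∞
      (fun p ↦ Bundle.TotalSpace.mk' (Euc m) (E := fun q : M ↦ TangentSpace (𝓡 m) q) p (X p))) :
    ContMDiff (𝓡 m) ((𝓡 d).prod 𝓘(ℝ, Euc d)) ∞
      (fun q ↦ Bundle.TotalSpace.mk' (Euc d) (E := fun x : N ↦ TangentSpace (𝓡 d) x)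
        (i q) (push d m i X q)) :=
  (ContMDiff.contMDiff_tangentMap hi (m := ∞) (by simp)).comp hX

omit [IsManifold (𝓡 d) ∞ N] in
theorem isInvertible_mfderiv_of_mem_maximalAtlas {e : OpenPartialHomeomorph N (Euc d)}
    (he : e ∈ IsManifold.maximalAtlas (𝓡 d) ∞ N) {x : N} (hx : x ∈ e.source) :
    (mfderiv (𝓡 d) (𝓡 d) e x).IsInvertible := by
  have h : e.MDifferentiable (𝓡 d) (𝓡 d) :=
    ⟨(contMDiffOn_of_mem_maximalAtlas he).mdifferentiableOn (by simp),
      (contMDiffOn_symm_of_mem_maximalAtlas he).mdifferentiableOn (by simp)⟩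
  exact ⟨h.mfderiv hx, rfl⟩

theorem mlieBracket_const (a b x : Euc d) :
    VectorField.mlieBracket (𝓡 d) (M := Euc d) (fun _ ↦ a) (fun _ ↦ b) x = 0 := by
  have h := congrFun (VectorField.mlieBracketWithin_eq_lieBracketWithin (𝕜 := ℝ) (E := Euc d)
    (V := fun _ ↦ a) (W := fun _ ↦ b) (s := Set.univ)) x
  rw [VectorField.lieBracketWithin_univ] at h
  have h0 : VectorField.lieBracket ℝ (fun _ : Euc d ↦ a) (fun _ ↦ b) x = 0 := by
    simp [VectorField.lieBracket_eq]
  exact h.trans h0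

/-- Coordinate fields of a chart straightening an immersion: tangent vectors of `M` extend to
commuting vector fields of `N` that are tangent to `M` along `M`. -/
theorem exists_commuting_tangent_extension {i : M → N} {p : M}
    (hi : Manifold.IsImmersionAt (𝓡 m) (𝓡 d) ∞ i p) :
    ∃ E : TangentSpace (𝓡 m) p → ∀ x : N, TangentSpace (𝓡 d) x,
      (∀ v, E v (i p) = mfderiv (𝓡 m) (𝓡 d) i p v) ∧
      (∀ v, MDifferentiableAt (𝓡 d) ((𝓡 d).prod 𝓘(ℝ, Euc d))
        (fun y ↦ Bundle.TotalSpace.mk' (Euc d) (E := fun z : N ↦ TangentSpace (𝓡 d) z) y (E v y))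
        (i p)) ∧
      (∀ v, ∀ᶠ q in 𝓝 p, E v (i q) ∈ tangent d m i q) ∧
      ∀ v w, VectorField.mlieBracket (𝓡 d) (E v) (E w) (i p) = 0 := by
  set e := hi.domChart
  set e' := hi.codChart
  let J : Euc m →L[ℝ] Euc d :=
    (hi.equiv : Euc m × hi.complement →L[ℝ] Euc d).comp (ContinuousLinearMap.inl ℝ _ _)
  have hloc : ∀ q ∈ e.source, e' (i q) = J (e q) := fun q hq ↦ codChart_apply_eq hi hq
  have hsrc : ∀ q ∈ e.source, i q ∈ e'.source := fun q hq ↦ hi.source_subset_preimage_source hq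
  have hder : ∀ q ∈ e.source, ∀ w : TangentSpace (𝓡 m) q,
      mfderiv (𝓡 d) (𝓡 d) e' (i q) (mfderiv (𝓡 m) (𝓡 d) i q w) =
        J (mfderiv (𝓡 m) (𝓡 m) e q w) := by
    intro q hq w
    have hiq : MDifferentiableAt (𝓡 m) (𝓡 d) i q :=
      ((hi.contMDiffOn q hq).contMDiffAt (e.open_source.mem_nhds hq)).mdifferentiableAt (by simp)
    have he'q : MDifferentiableAt (𝓡 d) (𝓡 d) e' (i q) :=
      (contMDiffAt_of_mem_maximalAtlas hi.codChart_mem_maximalAtlas (hsrc q hq)).mdifferentiableAt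
        (by simp)
    have heq : MDifferentiableAt (𝓡 m) (𝓡 m) e q :=
      (contMDiffAt_of_mem_maximalAtlas hi.domChart_mem_maximalAtlas hq).mdifferentiableAt (by simp)
    have hJ : MDifferentiableAt (𝓡 m) (𝓡 d) J (e q) := J.differentiableAt.mdifferentiableAt
    have h1 := mfderiv_comp q he'q hiq
    have h2 := mfderiv_comp q hJ heq
    have h3 : mfderiv (𝓡 m) (𝓡 d) (e' ∘ i) q = mfderiv (𝓡 m) (𝓡 d) (J ∘ e) q := by
      refine Filter.EventuallyEq.mfderiv_eq ?_
      filter_upwards [e.open_source.mem_nhds hq] with q' hq'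
      exact hloc q' hq'
    have h4 : mfderiv (𝓡 m) (𝓡 d) J (e q) = J := by
      rw [mfderiv_eq_fderiv]; exact J.fderiv
    rw [h1, h2, h4] at h3
    exact congrArg (fun L ↦ L w) h3
  have hp := hi.mem_domChart_source
  have hval : ∀ q ∈ e.source, ∀ w : TangentSpace (𝓡 m) q,
      (mfderiv (𝓡 d) (𝓡 d) e' (i q)).inverse (J (mfderiv (𝓡 m) (𝓡 m) e q w)) =
        mfderiv (𝓡 m) (𝓡 d) i q w := by
    intro q hq w
    rw [← hder q hq w]
    exact (isInvertible_mfderiv_of_mem_maximalAtlas hi.codChart_mem_maximalAtlas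
      (hsrc q hq)).inverse_apply_eq.2 rfl
  have hsm : ContMDiffAt (𝓡 d) (𝓡 d) ∞ e' (i p) :=
    contMDiffAt_of_mem_maximalAtlas hi.codChart_mem_maximalAtlas (hsrc p hp)
  have hconst : ∀ b : Euc d, MDifferentiableAt (𝓡 d) ((𝓡 d).prod 𝓘(ℝ, Euc d))
      (fun y ↦ Bundle.TotalSpace.mk' (Euc d) (E := fun z : Euc d ↦ TangentSpace (𝓡 d) z) y b)
      (e' (i p)) := by
    intro b
    exact ((contMDiffAt_vectorSpace_iff_contDiffAt (n := 1)
      (V := fun _ : Euc d ↦ (b : Euc d))).2 contDiffAt_const).mdifferentiableAt one_ne_zero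
  -- `E v` has constant components in the slice chart, namely the coordinates of `di(v)`. Constant
  -- fields commute and brackets are natural under pull-back.
  refine ⟨fun v ↦ VectorField.mpullback (𝓡 d) (𝓡 d) e'
    (fun _ ↦ (J (mfderiv (𝓡 m) (𝓡 m) e p v) : Euc d)), ?_, ?_, ?_, ?_⟩
  · intro v
    exact hval p hp v
  · intro v
    exact (hconst _).mpullback_vectorField hsm
      (isInvertible_mfderiv_of_mem_maximalAtlas hi.codChart_mem_maximalAtlas (hsrc p hp))
      two_le_infty
  · intro v
    filter_upwards [e.open_source.mem_nhds hp] with q hq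
    -- At a nearby point `q` of `M`, the required tangent vector is the one with the same
    -- coordinates in `domChart` as `v` has at `p`.
    obtain ⟨L, hL⟩ := isInvertible_mfderiv_of_mem_maximalAtlas hi.domChart_mem_maximalAtlas hq
    refine ⟨L.symm (mfderiv (𝓡 m) (𝓡 m) e p v), ?_⟩
    refine (hval q hq _).symm.trans ?_
    have h : mfderiv (𝓡 m) (𝓡 m) e q (L.symm (mfderiv (𝓡 m) (𝓡 m) e p v)) =
        mfderiv (𝓡 m) (𝓡 m) e p v :=
      (congrArg (fun A : TangentSpace (𝓡 m) q →L[ℝ] Euc m ↦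
        A (L.symm (mfderiv (𝓡 m) (𝓡 m) e p v))) hL.symm).trans (L.apply_symm_apply _)
    exact congrArg (fun b ↦ (mfderiv (𝓡 d) (𝓡 d) e' (i q)).inverse (J b)) h
  · intro v w
    have : IsManifold (𝓡 d) (minSmoothness ℝ 3) N := by
      simp only [minSmoothness_of_isRCLikeNormedField]; exact IsManifold.of_le (n := ∞) three_le_infty
    refine (VectorField.mpullback_mlieBracket (n := ∞) (hconst _) (hconst _) hsm
      (by simpa using two_le_infty)).symm.trans ?_
    rw [VectorField.mpullback_apply]
    exact (congrArg _ (mlieBracket_const _ _ _)).trans (map_zero _)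

end Immersion


/-! ### The skew tensor `φ` and the derivative of `ξ` on the ambient manifold. -/

section Ambient

variable {d : ℕ} {N : Type*} [TopologicalSpace N] [ChartedSpace (Euc d) N]
  [IsManifold (𝓡 d) ∞ N] {g : SemiRiemannianMetric d N}
  {nabla : CovariantDerivative (𝓡 d) (Euc d) (TangentSpace (𝓡 d) : N → Type _)}

theorem SemiRiemannianMetric.mdifferentiableAt_inner (g : SemiRiemannianMetric d N)
    {X Y : ∀ x : N, TangentSpace (𝓡 d) x} {x : N}
    (hX : MDifferentiableAt (𝓡 d) ((𝓡 d).prod 𝓘(ℝ, Euc d))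
      (fun y ↦ Bundle.TotalSpace.mk' (Euc d) (E := fun z : N ↦ TangentSpace (𝓡 d) z) y (X y)) x)
    (hY : MDifferentiableAt (𝓡 d) ((𝓡 d).prod 𝓘(ℝ, Euc d))
      (fun y ↦ Bundle.TotalSpace.mk' (Euc d) (E := fun z : N ↦ TangentSpace (𝓡 d) z) y (Y y)) x) :
    MDifferentiableAt (𝓡 d) 𝓘(ℝ, ℝ) (fun y ↦ g.inner y (X y) (Y y)) x := by
  have h : MDifferentiableAt (𝓡 d) ((𝓡 d).prod 𝓘(ℝ, ℝ))
      (fun y ↦ Bundle.TotalSpace.mk' ℝ (E := Bundle.Trivial N ℝ) y (g.inner y (X y) (Y y))) x := by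
    apply MDifferentiableAt.clm_bundle_apply₂ (F₁ := Euc d) (F₂ := Euc d)
    · exact (g.contMDiff x).mdifferentiableAt (by simp)
    · exact hX
    · exact hY
  simp only [mdifferentiableAt_totalSpace] at h
  exact h.2

theorem mdifferentiableAt_of_contMDiffAt {Y : ∀ x : N, TangentSpace (𝓡 d) x} {x : N}
    (hY : ContMDiffAt (𝓡 d) ((𝓡 d).prod 𝓘(ℝ, Euc d)) ∞
      (fun y ↦ Bundle.TotalSpace.mk' (Euc d) (E := fun z : N ↦ TangentSpace (𝓡 d) z) y (Y y)) x) :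
    MDifferentiableAt (𝓡 d) ((𝓡 d).prod 𝓘(ℝ, Euc d))
      (fun y ↦ Bundle.TotalSpace.mk' (Euc d) (E := fun z : N ↦ TangentSpace (𝓡 d) z) y (Y y)) x :=
  hY.mdifferentiableAt (by simp)

namespace AlmostContactMetric

variable (c : AlmostContactMetric g)

/-- Skewness of `φ` comes from metric compatibility applied to `v` and `φ w`: all `η`-terms drop
because `η ∘ φ = 0`. -/
theorem inner_phi_right (x : N) (v w : TangentSpace (𝓡 d) x) :
    g.inner x v (c.phi x w) = -g.inner x (c.phi x v) w := by
  have h := c.inner_phi_phi x v (c.phi x w)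
  rw [c.phi_phi, c.eta_phi, mul_zero, sub_zero, map_add, map_neg, map_smul, g.symm x (c.phi x v)
    (c.xi x), ← c.eta_eq, c.eta_phi, smul_zero, add_zero] at h
  exact h.symm

theorem contMDiffAt_phi {M : Type*} {m : ℕ} [TopologicalSpace M] [ChartedSpace (Euc m) M]
    {i : M → N} {p : M} (hi : ContMDiffAt (𝓡 m) (𝓡 d) ∞ i p)
    {Z : ∀ q : M, TangentSpace (𝓡 d) (i q)}
    (hZ : ContMDiffAt (𝓡 m) ((𝓡 d).prod 𝓘(ℝ, Euc d)) ∞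
      (fun q ↦ Bundle.TotalSpace.mk' (Euc d) (E := fun x : N ↦ TangentSpace (𝓡 d) x)
        (i q) (Z q)) p) :
    ContMDiffAt (𝓡 m) ((𝓡 d).prod 𝓘(ℝ, Euc d)) ∞
      (fun q ↦ Bundle.TotalSpace.mk' (Euc d) (E := fun x : N ↦ TangentSpace (𝓡 d) x)
        (i q) (c.phi (i q) (Z q))) p :=
  ContMDiffAt.clm_bundle_apply (ϕ := fun q ↦ c.phi (i q))
    ((c.phi_smooth (i p)).comp p hi) hZ

theorem mdifferentiableAt_eta {Y : ∀ x : N, TangentSpace (𝓡 d) x} {x : N}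
    (hY : MDifferentiableAt (𝓡 d) ((𝓡 d).prod 𝓘(ℝ, Euc d))
      (fun y ↦ Bundle.TotalSpace.mk' (Euc d) (E := fun z : N ↦ TangentSpace (𝓡 d) z) y (Y y)) x) :
    MDifferentiableAt (𝓡 d) 𝓘(ℝ, ℝ) (fun y ↦ c.eta y (Y y)) x := by
  simp only [c.eta_eq]
  exact g.mdifferentiableAt_inner (mdifferentiableAt_of_contMDiffAt (c.xi_smooth x)) hY

theorem inner_phi_phi_of_eta_eq_zero {x : N} (v : TangentSpace (𝓡 d) x)
    {w : TangentSpace (𝓡 d) x} (hw : c.eta x w = 0) :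
    g.inner x (c.phi x v) (c.phi x w) = g.inner x v w := by
  rw [c.inner_phi_phi, hw, mul_zero, sub_zero]

/-- Differentiate `φ² U = -U + η(U) ξ`. The term `η(U) ∇ξ` vanishes at `x`, and the remaining
multiple of `ξ` need not be known, since it is later paired with a vector orthogonal to `ξ`. -/
theorem exists_nabla_phi_phi {U : ∀ x : N, TangentSpace (𝓡 d) x} {x : N}
    (hU : MDifferentiableAt (𝓡 d) ((𝓡 d).prod 𝓘(ℝ, Euc d))
      (fun y ↦ Bundle.TotalSpace.mk' (Euc d) (E := fun z : N ↦ TangentSpace (𝓡 d) z) y (U y)) x)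
    (hx : c.eta x (U x) = 0) (v : TangentSpace (𝓡 d) x) :
    ∃ t : ℝ, nabla (fun y ↦ c.phi y (c.phi y (U y))) x v = -nabla U x v + t • c.xi x := by
  have hξ := mdifferentiableAt_of_contMDiffAt (c.xi_smooth x)
  have hη := c.mdifferentiableAt_eta hU
  have hm : MDifferentiableAt (𝓡 d) 𝓘(ℝ, ℝ) (fun _ : N ↦ (-1 : ℝ)) x := mdifferentiableAt_const
  have h : (fun y ↦ c.phi y (c.phi y (U y))) =
      (fun _ : N ↦ (-1 : ℝ)) • U + (fun y ↦ c.eta y (U y)) • c.xi := by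
    funext y
    simp [c.phi_phi]
  have h1 := nabla.isCovariantDerivativeOnUniv.leibniz hU hm
  have h2 := nabla.isCovariantDerivativeOnUniv.leibniz hξ hη
  have h3 := nabla.isCovariantDerivativeOnUniv.add (x := x)
    (hm.smul_section hU) (hη.smul_section hξ)
  refine ⟨mvfderiv (𝓡 d) (fun y ↦ c.eta y (U y)) x v, ?_⟩
  have h4 : mvfderiv (𝓡 d) (fun _ : N ↦ (-1 : ℝ)) x v = 0 :=
    congrArg (fun L ↦ L v) (mfderiv_const (c := (-1 : ℝ)) (I := 𝓡 d) (I' := 𝓘(ℝ, ℝ)) (x := x))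
  rw [h, h3, h1, h2]
  simp [hx, h4]

end AlmostContactMetric

variable {c : AlmostContactMetric g} {μ : ℝ}

/-- The relation between `∇ξ` and `φ` on a nearly `μ`-Sasakian manifold obtained from the
nearly Sasakian identity for the pairs `(X, ξ)` and `(φ X, ξ)`. -/
theorem IsNearlySasakian.inner_nabla_xi_sub (hμ : IsNearlySasakian nabla c μ) {x : N}
    {u w : TangentSpace (𝓡 d) x} (hu : c.eta x u = 0) (hw : c.eta x w = 0) :
    g.inner x (nabla c.xi x u) (c.phi x w) - g.inner x (nabla c.xi x (c.phi x u)) w =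
      -2 * μ * g.inner x u w := by
  let U : ∀ x : N, TangentSpace (𝓡 d) x := FiberBundle.extend (Euc d) u
  have hUx : U x = u := by simp [U]
  have hU : ContMDiffAt (𝓡 d) ((𝓡 d).prod 𝓘(ℝ, Euc d)) ∞
      (fun y ↦ Bundle.TotalSpace.mk' (Euc d) (E := fun z : N ↦ TangentSpace (𝓡 d) z) y (U y)) x :=
    FiberBundle.contMDiffAt_extend (k := ∞) (𝓡 d) (Euc d) u
  have hφU := c.contMDiffAt_phi (i := id) contMDiffAt_id hU
  have hξ0 : nabla (fun y ↦ c.phi y (c.xi y)) = 0 := by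
    have h : (fun y ↦ c.phi y (c.xi y)) = 0 := funext c.phi_xi
    rw [h, nabla.zero]
  have h1 := hμ U c.xi x hU (c.xi_smooth x)
  have h2 := hμ (fun y ↦ c.phi y (U y)) c.xi x hφU (c.xi_smooth x)
  obtain ⟨t, ht⟩ := c.exists_nabla_phi_phi (nabla := nabla)
    (mdifferentiableAt_of_contMDiffAt hU) (by rwa [hUx]) (c.xi x)
  have hξu : g.inner x u (c.xi x) = 0 := by rw [g.symm, ← c.eta_eq, hu]
  have hξφ (v : TangentSpace (𝓡 d) x) : g.inner x (c.xi x) (c.phi x v) = 0 := by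
    rw [← c.eta_eq, c.eta_phi]
  unfold covPhi at h1 h2
  rw [ht] at h2
  simp only [hξ0, hUx, c.eta_phi, hu, g.symm x (c.phi x u) (c.xi x), hξφ, hξu] at h1 h2
  -- Pair the identity for `(U, ξ)` with `w` and the one for `(φU, ξ)` with `φ w`. The derivatives
  -- of `U` and `φU` along `ξ` then cancel in the sum, leaving only derivatives of `ξ`.
  have e1 := congrArg (fun z ↦ g.inner x z w) h1
  have e2 := congrArg (fun z ↦ g.inner x z (c.phi x w)) h2
  simp only [map_add, map_sub, map_neg, map_smul, map_zero, zero_smul, mul_zero, add_apply,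
    sub_apply, neg_apply, smul_apply, zero_apply, Pi.zero_apply, c.eta_xi,
    c.inner_phi_phi_of_eta_eq_zero _ hw, hξφ, one_smul, zero_sub, smul_eq_mul] at e1 e2
  simp only [← neg_eq_iff_eq_neg.2 (c.inner_phi_right x _ w)] at e1
  linarith

end Ambient

/-! ### Consequences along a submanifold normal to `ξ`. -/

section Submanifold

variable {d m : ℕ} {N : Type*} [TopologicalSpace N] [ChartedSpace (Euc d) N]
  [IsManifold (𝓡 d) ∞ N]
  {M : Type*} [TopologicalSpace M] [ChartedSpace (Euc m) M]
  {g : SemiRiemannianMetric d N}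
  {nabla : CovariantDerivative (𝓡 d) (Euc d) (TangentSpace (𝓡 d) : N → Type _)}
  {c : AlmostContactMetric g} {μ : ℝ} {i : M → N} {p : M}

/-- If `ξ` is normal to an immersed submanifold, then `g(∇_X ξ, Y)` is symmetric on it. -/
theorem inner_nabla_normal_symm (hnabla : IsLeviCivita g nabla)
    (hi : Manifold.IsImmersionAt (𝓡 m) (𝓡 d) ∞ i p) {ξ : ∀ x : N, TangentSpace (𝓡 d) x}
    (hξ : MDifferentiableAt (𝓡 d) ((𝓡 d).prod 𝓘(ℝ, Euc d))
      (fun y ↦ Bundle.TotalSpace.mk' (Euc d) (E := fun z : N ↦ TangentSpace (𝓡 d) z) y (ξ y))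
      (i p))
    (hn : ∀ q, ∀ w ∈ tangent d m i q, g.inner (i q) (ξ (i q)) w = 0)
    {u w : TangentSpace (𝓡 d) (i p)} (hu : u ∈ tangent d m i p) (hw : w ∈ tangent d m i p) :
    g.inner (i p) (nabla ξ (i p) u) w = g.inner (i p) (nabla ξ (i p) w) u := by
  obtain ⟨u, rfl⟩ := hu
  obtain ⟨w, rfl⟩ := hw
  obtain ⟨E, hE, hEd, hEt, hEc⟩ := exists_commuting_tangent_extension hi
  -- `g(ξ, E w)` vanishes along `M` near `p`, so its derivative in the tangent direction `v` is
  -- zero; metric compatibility expands it.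
  have key : ∀ v w : TangentSpace (𝓡 m) p,
      g.inner (i p) (nabla ξ (i p) (E v (i p))) (E w (i p)) +
        g.inner (i p) (ξ (i p)) (nabla (E w) (i p) (E v (i p))) = 0 := by
    intro v w
    rw [← hnabla.metric ξ (E w) (i p) _ hξ (hEd w), hE v]
    have hip : MDifferentiableAt (𝓡 m) (𝓡 d) i p := hi.contMDiffAt.mdifferentiableAt (by simp)
    have h := mfderiv_comp p (g.mdifferentiableAt_inner hξ (hEd w)) hip
    have h0 : mfderiv (𝓡 m) 𝓘(ℝ, ℝ) ((fun y ↦ g.inner y (ξ y) (E w y)) ∘ i) p = 0 := by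
      have hz : ((fun y ↦ g.inner y (ξ y) (E w y)) ∘ i) =ᶠ[𝓝 p] fun _ ↦ (0 : ℝ) := by
        filter_upwards [hEt w] with q hq
        exact hn q _ hq
      exact hz.mfderiv_eq.trans mfderiv_const
    rw [h0] at h
    exact (congrArg (fun L : TangentSpace (𝓡 m) p →L[ℝ] ℝ ↦ L v) h).symm
  -- Torsion-freeness and commutation make `∇_{E u} E w` symmetric in `u, w` at the point.
  have htf := hnabla.torsion_free (E u) (E w) (i p) (hEd u) (hEd w)
  rw [hEc, sub_eq_zero] at htf
  have h1 := key u w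
  have h2 := key w u
  rw [htf] at h1
  rw [hE, hE] at h1 h2
  exact add_right_cancel (h1.trans h2.symm)

/-- On a nearly `μ`-Sasakian manifold, `μ g` vanishes on the `φ`-invariant tangent vectors of a
submanifold to which `ξ` is normal. -/
theorem mul_inner_eq_zero_of_invariant (hnabla : IsLeviCivita g nabla)
    (hμ : IsNearlySasakian nabla c μ)
    (hi : Manifold.IsImmersionAt (𝓡 m) (𝓡 d) ∞ i p)
    (hn : ∀ q, ∀ w ∈ tangent d m i q, c.eta (i q) w = 0)
    {u w : TangentSpace (𝓡 d) (i p)} (hu : u ∈ tangent d m i p) (hw : w ∈ tangent d m i p)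
    (hφu : c.phi (i p) u ∈ tangent d m i p) (hφw : c.phi (i p) w ∈ tangent d m i p) :
    μ * g.inner (i p) u w = 0 := by
  have hs {a b : TangentSpace (𝓡 d) (i p)} (ha : a ∈ tangent d m i p)
      (hb : b ∈ tangent d m i p) :
      g.inner (i p) (nabla c.xi (i p) a) b = g.inner (i p) (nabla c.xi (i p) b) a :=
    inner_nabla_normal_symm hnabla hi (mdifferentiableAt_of_contMDiffAt (c.xi_smooth (i p)))
      (fun q w hw ↦ by rw [← c.eta_eq]; exact hn q w hw) ha hb
  have h1 := hμ.inner_nabla_xi_sub (hn p u hu) (hn p w hw)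
  have h2 := hμ.inner_nabla_xi_sub (hn p w hw) (hn p u hu)
  -- After these rewrites the left sides of `h1` and `h2` are opposite and their right sides equal;
  -- adding them gives `0 = -4 μ g(u,w)`.
  rw [hs hφu hw] at h1
  rw [hs hφw hu, g.symm (i p) w u] at h2
  linarith

/-- The nearly Sasakian identity along a submanifold normal to `ξ`. -/
theorem IsNearlySasakian.covAlong_phi_add [IsManifold (𝓡 m) ∞ M]
    (hμ : IsNearlySasakian nabla c μ) (hi : Manifold.IsImmersion (𝓡 m) (𝓡 d) ∞ i)
    {X Y : ∀ q : M, TangentSpace (𝓡 m) q}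
    (hX : ContMDiff (𝓡 m) ((𝓡 m).prod 𝓘(ℝ, Euc m)) ∞
      (fun p ↦ Bundle.TotalSpace.mk' (Euc m) (E := fun q : M ↦ TangentSpace (𝓡 m) q) p (X p)))
    (hY : ContMDiff (𝓡 m) ((𝓡 m).prod 𝓘(ℝ, Euc m)) ∞
      (fun p ↦ Bundle.TotalSpace.mk' (Euc m) (E := fun q : M ↦ TangentSpace (𝓡 m) q) p (Y p)))
    (p : M) :
    covAlong nabla i (fun q ↦ c.phi (i q) (push d m i Y q)) p (X p) +
      covAlong nabla i (fun q ↦ c.phi (i q) (push d m i X q)) p (Y p) =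
      c.phi (i p) (covAlong nabla i (push d m i Y) p (X p) +
        covAlong nabla i (push d m i X) p (Y p)) +
      μ • ((2 * g.inner (i p) (push d m i X p) (push d m i Y p)) • c.xi (i p) -
        c.eta (i p) (push d m i Y p) • push d m i X p -
        c.eta (i p) (push d m i X p) • push d m i Y p) := by
  have hip := hi.isImmersionAt p
  have hd : MDifferentiableAt (𝓡 m) (𝓡 d) i p := hip.contMDiffAt.mdifferentiableAt (by simp)
  -- If `Z'` extends `Z`, then `φ Z'` extends `φ Z`, so both derivatives along `i` are ambient
  -- derivatives of fields on `N`, to which the nearly Sasakian identity applies.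
  have hcov {Z : ∀ q : M, TangentSpace (𝓡 d) (i q)} {Z' : ∀ x : N, TangentSpace (𝓡 d) x}
      (hZ' : ContMDiffAt (𝓡 d) ((𝓡 d).prod 𝓘(ℝ, Euc d)) ∞
        (fun y ↦ Bundle.TotalSpace.mk' (Euc d) (E := fun z : N ↦ TangentSpace (𝓡 d) z) y (Z' y))
        (i p)) (h : ∀ᶠ q in 𝓝 p, Z' (i q) = Z q) (W : ∀ q : M, TangentSpace (𝓡 m) q) :
      covAlong nabla i Z p (W p) = nabla Z' (i p) (push d m i W p) ∧
      covAlong nabla i (fun q ↦ c.phi (i q) (Z q)) p (W p) =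
        nabla (fun y ↦ c.phi y (Z' y)) (i p) (push d m i W p) := by
    constructor
    · rw [← covAlong_congr nabla h]
      exact covAlong_comp nabla i Z' p (W p) hd (mdifferentiableAt_of_contMDiffAt hZ')
    · rw [← covAlong_congr nabla (Z := fun q ↦ c.phi (i q) (Z' (i q))) (by
        filter_upwards [h] with q hq; rw [hq])]
      exact covAlong_comp nabla i (fun y ↦ c.phi y (Z' y)) p (W p) hd
        (mdifferentiableAt_of_contMDiffAt (c.contMDiffAt_phi (i := id) contMDiffAt_id hZ'))
  obtain ⟨X', hX's, hX'⟩ := exists_ambient_extension hip _ (contMDiff_push hi.contMDiff hX p)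
  obtain ⟨Y', hY's, hY'⟩ := exists_ambient_extension hip _ (contMDiff_push hi.contMDiff hY p)
  have h := hμ X' Y' (i p) hX's hY's
  unfold covPhi at h
  rw [hX'.self_of_nhds, hY'.self_of_nhds] at h
  rw [(hcov hX's hX' Y).1, (hcov hX's hX' Y).2, (hcov hY's hY' X).1, (hcov hY's hY' X).2, ← h,
    map_add]
  abel

end Submanifold


/-! ### Linear algebra of `TN = TM ⊕ tr(TM)`. -/

section Splitting

variable {d m : ℕ} {N : Type*} [TopologicalSpace N] [ChartedSpace (Euc d) N]
  [IsManifold (𝓡 d) ∞ N]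
  {M : Type*} [TopologicalSpace M] [ChartedSpace (Euc m) M]
  {g : SemiRiemannianMetric d N} {i : M → N} {r : ℕ}

namespace LightlikeSubmanifold

variable (S : LightlikeSubmanifold (m := m) g i r) (p : M)

theorem tanPart_eq_self {v : TangentSpace (𝓡 d) (i p)} (hv : v ∈ tangent d m i p) :
    S.tanPart p v = v :=
  Submodule.projection_apply_of_mem_left _ hv

theorem tanPart_mem (v : TangentSpace (𝓡 d) (i p)) : S.tanPart p v ∈ tangent d m i p :=
  Submodule.projection_apply_mem _ v

theorem trPart_mem (v : TangentSpace (𝓡 d) (i p)) : S.trPart p v ∈ S.tr p :=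
  Submodule.projection_apply_mem _ v

theorem trPart_of_mem_tangent {v : TangentSpace (𝓡 d) (i p)} (hv : v ∈ tangent d m i p) :
    S.trPart p v = 0 :=
  Submodule.projection_apply_of_mem_right _ hv

theorem trPart_eq_self {v : TangentSpace (𝓡 d) (i p)} (hv : v ∈ S.tr p) : S.trPart p v = v :=
  Submodule.projection_apply_of_mem_left _ hv

theorem trPart_add (v w : TangentSpace (𝓡 d) (i p)) :
    S.trPart p (v + w) = S.trPart p v + S.trPart p w :=
  map_add (Submodule.projection _ _ (S.isCompl_tr p).symm) v w

theorem tanPart_add (v w : TangentSpace (𝓡 d) (i p)) :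
    S.tanPart p (v + w) = S.tanPart p v + S.tanPart p w :=
  map_add (Submodule.projection _ _ (S.isCompl_tr p)) v w

theorem tanPart_add_trPart (v : TangentSpace (𝓡 d) (i p)) :
    S.tanPart p v + S.trPart p v = v := by
  obtain ⟨a, ha, b, hb, rfl⟩ := Submodule.mem_sup.1
    ((S.isCompl_tr p).sup_eq_top ▸ Submodule.mem_top : v ∈ tangent d m i p ⊔ (S.ltr p ⊔ S.scrPerp p))
  rw [S.tanPart_add, S.trPart_add, S.tanPart_eq_self p ha, S.trPart_of_mem_tangent p ha,
    S.trPart_eq_self p hb, show S.tanPart p b = 0 from Submodule.projection_apply_of_mem_right _ hb,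
    add_zero, zero_add]

theorem scr_le_tangent : S.scr p ≤ tangent d m i p :=
  le_sup_right.trans (S.scr_sup p).le

theorem scrPerp_le : S.scrPerp p ≤ perp g (tangent d m i p) :=
  le_sup_right.trans (S.scrPerp_sup p).le

theorem ltr_le : S.ltr p ≤ perp g (S.scr p) ⊓ perp g (S.scrPerp p) :=
  le_sup_right.trans (S.ltr_sup p).le

theorem inner_tr_scr {v w : TangentSpace (𝓡 d) (i p)} (hv : v ∈ S.tr p) (hw : w ∈ S.scr p) :
    g.inner (i p) v w = 0 := by
  obtain ⟨a, ha, b, hb, rfl⟩ := Submodule.mem_sup.1 hv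
  rw [map_add, add_apply, (S.ltr_le p ha).1 w hw, S.scrPerp_le p hb w (S.scr_le_tangent p hw),
    add_zero]

/-- The tangential part of `v` is orthogonal to every normal `w`, so projecting to `tr(TM)` does not
change the pairing. -/
theorem inner_trPart (v : TangentSpace (𝓡 d) (i p)) {w : TangentSpace (𝓡 d) (i p)}
    (hw : w ∈ perp g (tangent d m i p)) :
    g.inner (i p) (S.trPart p v) w = g.inner (i p) v w := by
  conv_rhs => rw [← S.tanPart_add_trPart p v, map_add, add_apply,
    g.symm _ (S.tanPart p v) w, hw _ (S.tanPart_mem p v), zero_add]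

end LightlikeSubmanifold

/-! ### The QGCR decomposition and the transversal part of `φ H`. -/

namespace QGCR

variable {c : AlmostContactMetric g}
  {S : LightlikeSubmanifold (m := m) g i r} (Q : QGCR c S) (p : M)

theorem phiMap_Sbar_le_scr : phiMap c (Q.Sbar p) ≤ S.scr p := by
  rw [← Q.scr_eq p]
  exact le_sup_of_le_left (le_sup_of_le_right le_sup_left)

theorem phiMap_L_le_scr : phiMap c (Q.L p) ≤ S.scr p := by
  rw [← Q.scr_eq p]
  exact le_sup_of_le_left (le_sup_of_le_right le_sup_right)

theorem D2_le_rad : Q.D2 p ≤ rad g m i p := le_sup_right.trans (Q.rad_eq p).le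

theorem D_le_tangent : Q.D p ≤ tangent d m i p := by
  refine sup_le (sup_le inf_le_left ?_) ((Q.phi_D2 p).trans (S.scr_le_tangent p))
  refine le_trans ?_ (S.scr_le_tangent p)
  rw [← Q.scr_eq p]
  exact le_sup_right

variable {Q}

theorem IsCoScreen.eta_eq_zero (hQ : Q.IsCoScreen) {v : TangentSpace (𝓡 d) (i p)}
    (hv : v ∈ tangent d m i p) : c.eta (i p) v = 0 := by
  rw [c.eta_eq]
  exact S.scrPerp_le p (hQ p) v hv

/-- The blocks `D₁` and `D₀` are each preserved, while `D₂` and `φ D₂` are exchanged because `φ² =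
-1` on vectors killed by `η`; the co-screen condition supplies `η = 0` on `TM`. -/
theorem IsCoScreen.phi_mem_D (hQ : Q.IsCoScreen) {v : TangentSpace (𝓡 d) (i p)}
    (hv : v ∈ Q.D p) : c.phi (i p) v ∈ Q.D p := by
  suffices h : Q.D p ≤ (Q.D p).comap
      (c.phi (i p) : TangentSpace (𝓡 d) (i p) →ₗ[ℝ] TangentSpace (𝓡 d) (i p)) from h hv
  have hrad : rad g m i p ≤ Q.D p := le_sup_of_le_left le_sup_left
  have hphi (W : Submodule ℝ (TangentSpace (𝓡 d) (i p))) (h : phiMap c W ≤ Q.D p) :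
      W ≤ (Q.D p).comap
        (c.phi (i p) : TangentSpace (𝓡 d) (i p) →ₗ[ℝ] TangentSpace (𝓡 d) (i p)) :=
    Submodule.map_le_iff_le_comap.1 h
  refine sup_le (sup_le ?_ ?_) ?_
  · rw [← Q.rad_eq p]
    refine sup_le (hphi _ ?_) (hphi _ le_sup_right)
    rw [Q.phi_D1 p]
    exact (le_sup_left.trans (Q.rad_eq p).le).trans hrad
  · exact hphi _ ((Q.phi_D0 p).trans (le_sup_of_le_left le_sup_right))
  · rintro _ ⟨w, hw, rfl⟩
    have hw' := Q.D2_le_rad p hw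
    change c.phi (i p) (c.phi (i p) w) ∈ Q.D p
    rw [c.phi_phi, hQ.eta_eq_zero p hw'.1, zero_smul, add_zero]
    exact neg_mem (hrad hw')

/-- The two pairings separate the summands of `tr(TM)`: `S(TM^⊥)` is orthogonal to `D₂ ⊂ TM`, and
`ltr(TM)` is orthogonal to `𝒮 ⊂ S(TM^⊥)`. -/
theorem mem_noLS {V : TangentSpace (𝓡 d) (i p)} (hV : V ∈ S.tr p)
    (h2 : ∀ e ∈ Q.D2 p, g.inner (i p) V e = 0) (hS : ∀ e ∈ Q.Sbar p, g.inner (i p) V e = 0) :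
    V ∈ Q.noLS p := by
  obtain ⟨a, ha, b, hb, rfl⟩ := Submodule.mem_sup.1 hV
  refine Submodule.add_mem_sup ⟨ha, fun e he ↦ ?_⟩ ⟨hb, fun e he ↦ ?_⟩
  · have h := h2 e he
    rwa [map_add, add_apply, S.scrPerp_le p hb e (Q.D2_le_rad p he).1, add_zero] at h
  · have h := hS e he
    rwa [map_add, add_apply, (S.ltr_le p ha).2 e (Q.Sbar_le p he), zero_add] at h

/-- For `e` in `D₂` or `𝒮`, normality of `e` and skewness of `φ` give `g(tr(φ H), e) = -g(H, φ e)`,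
which vanishes because `φ e ∈ S(TM)` and `tr(TM) ⊥ S(TM)`. -/
theorem trPart_phi_mem_noLS {H : TangentSpace (𝓡 d) (i p)} (hH : H ∈ S.tr p) :
    S.trPart p (c.phi (i p) H) ∈ Q.noLS p := by
  have key {e : TangentSpace (𝓡 d) (i p)} (he : e ∈ perp g (tangent d m i p))
      (hφe : c.phi (i p) e ∈ S.scr p) : g.inner (i p) (S.trPart p (c.phi (i p) H)) e = 0 := by
    rw [S.inner_trPart p _ he, ← neg_eq_zero, ← c.inner_phi_right]
    exact S.inner_tr_scr p hH hφe
  refine mem_noLS p (S.trPart_mem p _) (fun e he ↦ key (Q.D2_le_rad p he).2 ?_)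
    (fun e he ↦ key (S.scrPerp_le p (Q.Sbar_le p he)) ?_)
  · exact Q.phi_D2 p ⟨e, he, rfl⟩
  · exact Q.phiMap_Sbar_le_scr p ⟨e, he, rfl⟩

/-- Of the four components of `H`, those in `ℒ` and `𝒮` become tangent under `φ` and the one along
`ξ` is killed; only the component in `G` survives, and `φ` keeps it in `G`. -/
theorem IsInvariantComplement.trPart_phi_mem {G : Submodule ℝ (TangentSpace (𝓡 d) (i p))}
    (hG : Q.IsInvariantComplement p G) {H : TangentSpace (𝓡 d) (i p)} (hH : H ∈ S.tr p) :
    S.trPart p (c.phi (i p) H) ∈ G := by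
  have hGtr : G ≤ S.tr p := by
    rw [← hG.sup_eq]
    exact le_sup_of_le_left le_sup_right
  rw [← hG.sup_eq] at hH
  obtain ⟨y, hy, x, hx, rfl⟩ := Submodule.mem_sup.1 hH
  obtain ⟨z, hz, γ, hγ, rfl⟩ := Submodule.mem_sup.1 hy
  obtain ⟨l, hl, s, hs, rfl⟩ := Submodule.mem_sup.1 hz
  obtain ⟨t, rfl⟩ := Submodule.mem_span_singleton.1 hx
  have hφγ : c.phi (i p) γ ∈ G := hG.phi_G.le ⟨γ, hγ, rfl⟩
  have h1 : c.phi (i p) l ∈ tangent d m i p :=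
    S.scr_le_tangent p (Q.phiMap_L_le_scr p ⟨l, hl, rfl⟩)
  have h2 : c.phi (i p) s ∈ tangent d m i p :=
    S.scr_le_tangent p (Q.phiMap_Sbar_le_scr p ⟨s, hs, rfl⟩)
  rw [map_add, map_add, map_add, map_smul, c.phi_xi, smul_zero, add_zero, S.trPart_add,
    S.trPart_of_mem_tangent p (add_mem h1 h2), zero_add, S.trPart_eq_self p (hGtr hφγ)]
  exact hφγ

/-- If `D` is nearly auto-parallel then `h(X, φ Y) + h(Y, φ₁ X)` is the transversal part of
`φ (h(X, Y) + h(Y, X))`. -/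
theorem IsNearlyAutoParallel.secondForm_add_eq [IsManifold (𝓡 m) ∞ M]
    {nabla : CovariantDerivative (𝓡 d) (Euc d) (TangentSpace (𝓡 d) : N → Type _)}
    (hD : Q.IsNearlyAutoParallel nabla) (hQ : Q.IsCoScreen) (hnabla : IsLeviCivita g nabla)
    {μ : ℝ} (hμ : IsNearlySasakian nabla c μ) (hi : Manifold.IsImmersion (𝓡 m) (𝓡 d) ∞ i)
    {X Y : ∀ p : M, TangentSpace (𝓡 m) p} (hX : Q.IsSectionD X) (hY : Q.IsSectionD Y) :
    S.secondForm nabla X (fun q ↦ c.phi (i q) (push d m i Y q)) p +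
        S.secondForm nabla Y (fun q ↦ S.tanPart q (c.phi (i q) (push d m i X q))) p =
      S.trPart p (c.phi (i p) (S.secondForm nabla X (push d m i Y) p +
        S.secondForm nabla Y (push d m i X) p)) := by
  have htan {Z : ∀ p : M, TangentSpace (𝓡 m) p} (hZ : Q.IsSectionD Z) (q : M) :
      c.phi (i q) (push d m i Z q) ∈ tangent d m i q :=
    Q.D_le_tangent q (hQ.phi_mem_D q (hZ.2 q))
  have hXp := Q.D_le_tangent p (hX.2 p)
  have hYp := Q.D_le_tangent p (hY.2 p)
  have hg : μ * g.inner (i p) (push d m i X p) (push d m i Y p) = 0 :=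
    mul_inner_eq_zero_of_invariant hnabla hμ (hi.isImmersionAt p)
      (fun q w hw ↦ hQ.eta_eq_zero q hw) hXp hYp (htan hX p) (htan hY p)
  have hfun : (fun q ↦ S.tanPart q (c.phi (i q) (push d m i X q))) =
      fun q ↦ c.phi (i q) (push d m i X q) :=
    funext fun q ↦ S.tanPart_eq_self q (htan hX q)
  have hmain := hμ.covAlong_phi_add hi hX.1 hY.1 p
  rw [hQ.eta_eq_zero p hXp, hQ.eta_eq_zero p hYp, zero_smul, zero_smul, sub_zero, sub_zero,
    smul_smul, mul_left_comm, hg, mul_zero, zero_smul, add_zero] at hmain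
  have hpar := hD X Y hX hY p
  unfold LightlikeSubmanifold.inducedConn at hpar
  unfold LightlikeSubmanifold.secondForm
  rw [← S.tanPart_add] at hpar
  rw [hfun, ← S.trPart_add, ← S.trPart_add, hmain]
  set C := covAlong nabla i (push d m i Y) p (X p) + covAlong nabla i (push d m i X) p (Y p)
  conv_lhs => rw [← S.tanPart_add_trPart p C, map_add, S.trPart_add,
    -- The tangential part of `C` lies in `D` by near auto-parallelism, so its image under `φ` is
    -- again tangent and has no transversal part.
    S.trPart_of_mem_tangent p (Q.D_le_tangent p (hQ.phi_mem_D p hpar)), zero_add]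

end QGCR

end Splitting

end

end LightlikeGeometry

theorem mainTheorem6 {n m r : ℕ} {N : Type*} [TopologicalSpace N]
    [ChartedSpace (LightlikeGeometry.Euc (2 * n + 1)) N] [IsManifold (𝓡 (2 * n + 1)) ∞ N]
    {M : Type*} [TopologicalSpace M] [ChartedSpace (LightlikeGeometry.Euc m) M]
    [IsManifold (𝓡 m) ∞ M]
    (g : LightlikeGeometry.SemiRiemannianMetric (2 * n + 1) N)
    (nabla : CovariantDerivative (𝓡 (2 * n + 1)) (LightlikeGeometry.Euc (2 * n + 1))
      (TangentSpace (𝓡 (2 * n + 1)) : N → Type _))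
    (hnabla : LightlikeGeometry.IsLeviCivita g nabla)
    (c : LightlikeGeometry.AlmostContactMetric g) (μ : ℝ)
    (hμ : LightlikeGeometry.IsNearlySasakian nabla c μ)
    (i : M → N) (hi : Manifold.IsImmersion (𝓡 m) (𝓡 (2 * n + 1)) ∞ i)
    (S : LightlikeGeometry.LightlikeSubmanifold (m := m) g i r)
    (Q : LightlikeGeometry.QGCR c S) (hQ : Q.IsCoScreen)
    (hD : Q.IsNearlyAutoParallel nabla) :
    ∀ X Y : ∀ p : M, TangentSpace (𝓡 m) p, Q.IsSectionD X → Q.IsSectionD Y → ∀ p : M,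
      let V : TangentSpace (𝓡 (2 * n + 1)) (i p) :=
        S.secondForm nabla X
            (fun q ↦ c.phi (i q) (LightlikeGeometry.push (2 * n + 1) m i Y q)) p +
          S.secondForm nabla Y
            (fun q ↦ S.tanPart q
              (c.phi (i q) (LightlikeGeometry.push (2 * n + 1) m i X q))) p
      V ∈ Q.noLS p ∧
        ∀ G : Submodule ℝ (TangentSpace (𝓡 (2 * n + 1)) (i p)),
          Q.IsInvariantComplement p G →
            V ∈ G ⊔ Submodule.span ℝ {c.xi (i p)} := by
  intro X Y hX hY p V
  have hV : V = S.trPart p (c.phi (i p)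
      (S.secondForm nabla X (LightlikeGeometry.push (2 * n + 1) m i Y) p +
        S.secondForm nabla Y (LightlikeGeometry.push (2 * n + 1) m i X) p)) :=
    hD.secondForm_add_eq p hQ hnabla hμ hi hX hY
  have hH := add_mem (S.trPart_mem p (LightlikeGeometry.covAlong nabla i
      (LightlikeGeometry.push (2 * n + 1) m i Y) p (X p)))
    (S.trPart_mem p (LightlikeGeometry.covAlong nabla i
      (LightlikeGeometry.push (2 * n + 1) m i X) p (Y p)))
  rw [hV]
  -- `V` even lies in `G` itself: as `μ g(X,Y) = 0`, no multiple of `ξ` occurs.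
  exact ⟨LightlikeGeometry.QGCR.trPart_phi_mem_noLS p hH,
    fun G hG ↦ Submodule.mem_sup_left (hG.trPart_phi_mem p hH)⟩
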